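/- Let $\mu$ be a Borel probability measure whose support is contained in a compact set $\Sigma\subset\mathbb{R}$. Suppose that $$\int_\Sigma \log|Q(x)|\,d\mu(x)\ \ge\ 0\qquad\text{for every nonzero polynomial } Q\in\mathbb{Z}[x],$$ where $\log 0=-\infty$ and the integrals take values in $\mathbb{R}\cup\{-\infty\}$. Then the logarithmic energy $$I(\mu)\ =\ \int_\Sigma\int_\Sigma -\log|z-w|\,d\mu(w)\,d\mu(z)\ \in\ \mathbb{R}\cup\{+\infty\}$$ satisfies $I(\mu)\le 0$. -/

import Mathlib

open MeasureTheory

namespace LogPotential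

/-- The integral `∫ f dμ` of an extended-real-valued function: the integral of the positive part
minus the integral of the negative part, as an extended real number. It is the usual Lebesgue
integral whenever the two are not both infinite; this is the case for all integrals below when
the measure is finite with compact support, the integrand then being bounded on one side on that
support. -/
noncomputable def extIntegral {X : Type*} [MeasurableSpace X] (μ : Measure X) (f : X → EReal) :
    EReal :=
  ((∫⁻ x, (f x).toENNReal ∂μ : ENNReal) : EReal) -
    ((∫⁻ x, (-f x).toENNReal ∂μ : ENNReal) : EReal)

/-- `log |x|` as an extended real number, with `log 0 = -∞`. -/
noncomputable def logAbs {E : Type*} [NormedAddCommGroup E] (x : E) : EReal :=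
  ENNReal.log ‖x‖ₑ

/-- The logarithmic potential `U^μ(z) = ∫ -log |z - w| dμ(w)`. -/
noncomputable def potential {E : Type*} [NormedAddCommGroup E] [MeasurableSpace E]
    (μ : Measure E) (z : E) : EReal :=
  extIntegral μ (fun w => -logAbs (z - w))

/-- The logarithmic energy `I(μ) = ∫ U^μ dμ = ∫ ∫ -log |z - w| dμ(w) dμ(z)`. -/
noncomputable def energy {E : Type*} [NormedAddCommGroup E] [MeasurableSpace E]
    (μ : Measure E) : EReal :=
  extIntegral μ (potential μ)

end LogPotential

/-! Let `g` be the potential of `μ` for the kernel `-log √((x - y)² + ε²)`, and `κ = ∫ g dμ`.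
Testing the hypothesis on an integral polynomial `Q` of degree below `n` with `|Q| ≤ exp (nκ/2 - n g
+ O(log n))` on an interval carrying `μ` gives `0 ≤ -nκ/2 + O(log n)`, with constants depending on
`ε`. Hence `κ ≤ 0`, and `ε → 0` gives `I(μ) ≤ 0` by monotone convergence.

Such a `Q` comes from Minkowski's theorem applied to the values of `e^{ng} Q` at weighted Fekete
points, where the determinant is maximal; Cramer's rule carries smallness there to the whole
interval, at the cost of a factor `n` (`exists_int_ne_zero_abs_dotProduct_le`). The determinant is a
weighted Vandermonde. Its bound `exp (n²κ/2 + O(n))` follows from conditional positive definiteness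
of the kernel, averaged over `n` independent points of law `μ` (`two_mul_sum_smoothPotential_le`).
-/

namespace LogPotential

open Filter Topology ProbabilityTheory
open scoped Matrix

/-! ### Geometry of numbers and Fekete points -/

/-- **Minkowski's theorem on linear forms.** -/
theorem exists_int_ne_zero_abs_mulVec_lt {ι : Type*} [Fintype ι] [DecidableEq ι]
    (A : Matrix ι ι ℝ) (hA : A.det ≠ 0) {s : ℝ} (hs : 0 < s) (h : |A.det| < s ^ Fintype.card ι) :
    ∃ v : ι → ℤ, v ≠ 0 ∧ ∀ i, |(A *ᵥ fun j => (v j : ℝ)) i| < s := by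
  classical
  have hdet : LinearMap.det (Matrix.toLin' A) = A.det := LinearMap.det_toLin' A
  have fund := ZSpan.isAddFundamentalDomain' (Pi.basisFun ℝ ι) volume
  have : Countable (Submodule.span ℤ (Set.range (Pi.basisFun ℝ ι))).toAddSubgroup := by
    change Countable (Submodule.span ℤ (Set.range (Pi.basisFun ℝ ι)))
    infer_instance
  have hmem : ∀ x : ι → ℝ, x ∈ Matrix.toLin' A ⁻¹' Set.univ.pi (fun _ => Set.Ioo (-s) s) ↔
      ∀ i, |(A *ᵥ x) i| < s := by
    intro x
    simp [Set.mem_pi, abs_lt]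
  obtain ⟨⟨x, hx⟩, hx0, hxs⟩ := exists_ne_zero_mem_lattice_of_measure_mul_two_pow_lt_measure
    (s := Matrix.toLin' A ⁻¹' Set.univ.pi (fun _ => Set.Ioo (-s) s)) fund
    (by
      intro x hx
      rw [hmem] at hx ⊢
      intro i
      simpa [Matrix.mulVec_neg] using hx i)
    ((convex_pi fun i _ => convex_Ioo (-s) s).linear_preimage _)
    (by
      rw [Measure.addHaar_preimage_linearMap _ (by rwa [hdet]), hdet,
        ZSpan.fundamentalDomain_pi_basisFun, volume_pi_pi, volume_pi_pi]
      simp only [Real.volume_Ico, Real.volume_Ioo, Finset.prod_const, Finset.card_univ,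
        Module.finrank_pi, sub_zero, ENNReal.ofReal_one, one_pow, one_mul]
      rw [show s - -s = 2 * s by ring, ← ENNReal.ofReal_pow (by positivity), ← ENNReal.ofReal_mul (abs_nonneg _),
        show (2 : ENNReal) = ENNReal.ofReal 2 by simp, ← ENNReal.ofReal_pow (by norm_num)]
      have hpos : 0 < |A.det| := abs_pos.mpr hA
      refine (ENNReal.ofReal_lt_ofReal_iff (by positivity)).mpr ?_
      rw [abs_inv, mul_pow, inv_mul_eq_div, lt_div_iff₀ hpos]
      gcongr)
  have hx' := ((Pi.basisFun ℝ ι).mem_span_iff_repr_mem ℤ x).mp hx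
  simp only [Pi.basisFun_repr, Set.mem_range, algebraMap_int_eq, eq_intCast] at hx'
  choose v hv using hx'
  have hvx : (fun j => (v j : ℝ)) = x := funext hv
  refine ⟨v, ?_, ?_⟩
  · rintro rfl
    apply hx0
    ext i
    simp [← hv i]
  · rw [hvx]
    exact (hmem x).mp hxs

/-- At a family of points maximising the determinant of a system of functions, every function in
the span of the system is controlled by its values at these points. -/
theorem abs_dotProduct_le_sum_of_det_maximal {X ι : Type*} [Fintype ι] [DecidableEq ι]
    (φ : X → ι → ℝ) (s : Set X) (z : ι → X) (hz : ∀ i, z i ∈ s)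
    (hdet : (Matrix.of fun i => φ (z i)).det ≠ 0)
    (hmax : ∀ y : ι → X, (∀ i, y i ∈ s) →
      |(Matrix.of fun i => φ (y i)).det| ≤ |(Matrix.of fun i => φ (z i)).det|)
    (a : ι → ℝ) {x : X} (hx : x ∈ s) :
    |φ x ⬝ᵥ a| ≤ ∑ i, |φ (z i) ⬝ᵥ a| := by
  set A : Matrix ι ι ℝ := Matrix.of fun i => φ (z i) with hA
  -- Lagrange interpolation: by Cramer's rule the coefficients are quotients of determinants with
  -- one node replaced by `x`, so maximality bounds them by 1.
  have hcr : Aᵀ *ᵥ Matrix.cramer Aᵀ (φ x) = A.det • φ x := by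
    rw [Matrix.mulVec_cramer, Matrix.det_transpose]
  have h1 : A.det * (φ x ⬝ᵥ a) = ∑ i, (A.updateRow i (φ x)).det * (φ (z i) ⬝ᵥ a) := by
    rw [← smul_eq_mul, ← smul_dotProduct, ← hcr, Matrix.mulVec_transpose,
      ← Matrix.dotProduct_mulVec]
    simp only [dotProduct, Matrix.mulVec, Matrix.cramer_transpose_apply, hA, Matrix.of_apply]
  have h2 : ∀ i, |(A.updateRow i (φ x)).det| ≤ |A.det| := by
    intro i
    have : A.updateRow i (φ x) = Matrix.of fun k => φ (Function.update z i x k) := by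
      ext k j
      by_cases hk : k = i
      · subst hk; simp
      · simp [Matrix.updateRow_ne hk, Function.update_of_ne hk, hA]
    rw [this]
    refine hmax _ fun k => ?_
    by_cases hk : k = i
    · subst hk; simpa using hx
    · simpa [Function.update_of_ne hk] using hz k
  have hpos : 0 < |A.det| := abs_pos.mpr hdet
  refine le_of_mul_le_mul_left ?_ hpos
  rw [← abs_mul, h1, Finset.mul_sum]
  refine (Finset.abs_sum_le_sum_abs _ _).trans (Finset.sum_le_sum fun i _ => ?_)
  rw [abs_mul]
  exact mul_le_mul_of_nonneg_right (h2 i) (abs_nonneg _)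

/-- An integral combination of continuous functions on a compact set can be made as small as
the `n`-th root of the maximal determinant of the system. -/
theorem exists_int_ne_zero_abs_dotProduct_le {n : ℕ} (φ : ℝ → Fin n → ℝ) (hφ : Continuous φ)
    {s : Set ℝ} (hs : IsCompact s) (y : Fin n → ℝ) (hy : ∀ i, y i ∈ s)
    (hy0 : (Matrix.of fun i => φ (y i)).det ≠ 0) {r : ℝ} (hr : 0 < r)
    (hb : ∀ z : Fin n → ℝ, |(Matrix.of fun i => φ (z i)).det| < r ^ n) :
    ∃ v : Fin n → ℤ, v ≠ 0 ∧ ∀ x ∈ s, |φ x ⬝ᵥ fun j => (v j : ℝ)| ≤ n * r := by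
  obtain ⟨z, hz, hmax⟩ := (isCompact_univ_pi fun _ : Fin n => hs).exists_isMaxOn
    ⟨y, fun i _ => hy i⟩ (f := fun z => |(Matrix.of fun i => φ (z i)).det|)
    (Continuous.continuousOn (by
      refine continuous_abs.comp (Continuous.matrix_det ?_)
      refine continuous_matrix fun i j => ?_
      exact (continuous_apply j).comp (hφ.comp (continuous_apply i))))
  have hmax' : ∀ y : Fin n → ℝ, (∀ i, y i ∈ s) →
      |(Matrix.of fun i => φ (y i)).det| ≤ |(Matrix.of fun i => φ (z i)).det| :=
    fun y hy => hmax (fun i _ => hy i)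
  have hz0 : (Matrix.of fun i => φ (z i)).det ≠ 0 :=
    abs_pos.mp ((abs_pos.mpr hy0).trans_le (hmax' y hy))
  obtain ⟨v, hv0, hv⟩ := exists_int_ne_zero_abs_mulVec_lt _ hz0 hr (by simpa using hb z)
  refine ⟨v, hv0, fun x hx => ?_⟩
  refine (abs_dotProduct_le_sum_of_det_maximal φ s z (fun i => hz i trivial) hz0 hmax' _ hx).trans ?_
  calc _ ≤ ∑ _i : Fin n, r := Finset.sum_le_sum fun i _ => (hv i).le
    _ = n * r := by simp

/-! ### The smoothed logarithmic kernel -/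

/-- The Cauchy kernel is `∫₀^∞ e^{-tu} cos (du) du`, and the quadratic form of `cos ((x i - x j) u)`
is a sum of two squares. -/
theorem sum_sum_mul_cauchy_nonneg {ι : Type*} [Fintype ι] (c x : ι → ℝ) {t : ℝ} (ht : 0 < t) :
    0 ≤ ∑ i, ∑ j, c i * c j * (t / ((x i - x j) ^ 2 + t ^ 2)) := by
  have hre : ∀ d : ℝ, ((-t + d * Complex.I : ℂ)).re < 0 := fun d => by simpa using ht
  have hint : ∀ d : ℝ, IntegrableOn (fun u : ℝ => Real.exp (-t * u) * Real.cos (d * u))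
      (Set.Ioi 0) := by
    intro d
    have h := (integrableOn_exp_mul_complex_Ioi (hre d) 0).re
    refine h.congr (Eventually.of_forall fun u => ?_)
    simp [Complex.exp_re]
  have hval : ∀ d : ℝ, ∫ u in Set.Ioi (0 : ℝ), Real.exp (-t * u) * Real.cos (d * u) =
      t / (d ^ 2 + t ^ 2) := by
    intro d
    have h := integral_exp_mul_complex_Ioi (hre d) 0
    have h2 := congrArg Complex.re h
    rw [← RCLike.re_eq_complex_re, ← integral_re (integrableOn_exp_mul_complex_Ioi (hre d) 0)] at h2
    have h3 : ∀ u : ℝ, RCLike.re (Complex.exp ((-t + d * Complex.I : ℂ) * u)) =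
        Real.exp (-t * u) * Real.cos (d * u) := fun u => by simp [Complex.exp_re]
    simp only [h3] at h2
    rw [h2]
    simp [Complex.div_re, Complex.normSq_apply]
    ring
  simp_rw [← hval, ← integral_const_mul]
  have hsum : ∀ i, ∑ j, ∫ u in Set.Ioi (0 : ℝ),
      c i * c j * (Real.exp (-t * u) * Real.cos ((x i - x j) * u)) =
      ∫ u in Set.Ioi (0 : ℝ), ∑ j,
        c i * c j * (Real.exp (-t * u) * Real.cos ((x i - x j) * u)) := fun i =>
    (integral_finsetSum _ fun j _ => (hint _).const_mul _).symm
  simp_rw [hsum]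
  rw [← integral_finsetSum _ fun i _ => integrable_finsetSum _ fun j _ => (hint _).const_mul _]
  refine integral_nonneg fun u => ?_
  have : ∑ i, ∑ j, c i * c j * (Real.exp (-t * u) * Real.cos ((x i - x j) * u)) =
      Real.exp (-t * u) * ((∑ i, c i * Real.cos (x i * u)) ^ 2 +
        (∑ i, c i * Real.sin (x i * u)) ^ 2) := by
    rw [sq, sq, Finset.sum_mul_sum, Finset.sum_mul_sum, ← Finset.sum_add_distrib, Finset.mul_sum]
    refine Finset.sum_congr rfl fun i _ => ?_
    rw [← Finset.sum_add_distrib, Finset.mul_sum]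
    refine Finset.sum_congr rfl fun j _ => ?_
    rw [sub_mul, Real.cos_sub]
    ring
  simp only [this, Pi.zero_apply]
  positivity

/-- The logarithmic kernel smoothed at scale `ε`. -/
noncomputable def smoothKernel (ε x y : ℝ) : ℝ := -(Real.log ((x - y) ^ 2 + ε ^ 2) / 2)

theorem smoothKernel_comm (ε x y : ℝ) : smoothKernel ε x y = smoothKernel ε y x := by
  rw [smoothKernel, smoothKernel, ← neg_sub, neg_sq]

theorem smoothKernel_self {ε : ℝ} (x : ℝ) : smoothKernel ε x x = -Real.log ε := by
  simp [smoothKernel]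

theorem continuous_smoothKernel {ε : ℝ} (hε : 0 < ε) :
    Continuous (Function.uncurry (smoothKernel ε)) := by
  unfold smoothKernel Function.uncurry
  refine ((Continuous.log (by fun_prop) fun p => ?_).div_const 2).neg
  positivity

theorem abs_sub_le_exp_neg_smoothKernel {ε : ℝ} (hε : 0 < ε) (x y : ℝ) :
    |x - y| ≤ Real.exp (-smoothKernel ε x y) := by
  have hp : 0 < (x - y) ^ 2 + ε ^ 2 := by positivity
  rw [smoothKernel, neg_neg, Real.exp_half, Real.exp_log hp]
  exact Real.abs_le_sqrt (by nlinarith [sq_nonneg ε])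

theorem smoothKernel_anti {ε δ : ℝ} (hδ : 0 < δ) (h : δ ≤ ε) (x y : ℝ) :
    smoothKernel ε x y ≤ smoothKernel δ x y := by
  unfold smoothKernel
  gcongr

theorem tendsto_smoothKernel (x y : ℝ) :
    Tendsto (fun ε => (smoothKernel ε x y : EReal)) (𝓝[>] 0) (𝓝 (-logAbs (x - y))) := by
  have h1 : ∀ ε ∈ Set.Ioi (0 : ℝ), -ENNReal.log (ENNReal.ofReal √((x - y) ^ 2 + ε ^ 2)) =
      (smoothKernel ε x y : EReal) := by
    intro ε hε
    have hε : 0 < ε := hε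
    have hp : 0 < (x - y) ^ 2 + ε ^ 2 := by positivity
    rw [ENNReal.log_ofReal_of_pos (Real.sqrt_pos.mpr hp), Real.log_sqrt hp.le, smoothKernel,
      EReal.coe_neg]
  refine Tendsto.congr' (eventually_nhdsWithin_of_forall h1) ?_
  refine tendsto_nhdsWithin_of_tendsto_nhds ?_
  have hc : Continuous fun ε : ℝ => -ENNReal.log (ENNReal.ofReal √((x - y) ^ 2 + ε ^ 2)) :=
    continuous_neg.comp (ENNReal.continuous_log.comp (ENNReal.continuous_ofReal.comp
      (by fun_prop)))
  have := hc.tendsto 0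
  simpa [logAbs, Real.sqrt_sq_eq_abs, Real.enorm_eq_ofReal_abs] using this

/-- The smoothed logarithmic kernel is conditionally positive definite. -/
theorem sum_sum_mul_smoothKernel_nonneg {ι : Type*} [Fintype ι] (c x : ι → ℝ)
    (hc : ∑ i, c i = 0) {ε : ℝ} (hε : 0 < ε) :
    0 ≤ ∑ i, ∑ j, c i * c j * smoothKernel ε (x i) (x j) := by
  -- As a function of the scale, `f` has the Cauchy form as derivative, so it increases; it tends to
  -- 0 at infinity because `∑ c i = 0` cancels the `log t` terms. Hence `f ≤ 0`.
  set f : ℝ → ℝ := fun t => ∑ i, ∑ j, c i * c j * (Real.log ((x i - x j) ^ 2 + t ^ 2) / 2) with hf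
  have hder : ∀ t : ℝ, 0 < t → HasDerivAt f
      (∑ i, ∑ j, c i * c j * (t / ((x i - x j) ^ 2 + t ^ 2))) t := by
    intro t ht
    refine HasDerivAt.fun_sum fun i _ => HasDerivAt.fun_sum fun j _ => ?_
    have hp : (x i - x j) ^ 2 + t ^ 2 ≠ 0 := by positivity
    have h := ((((hasDerivAt_pow 2 t).const_add ((x i - x j) ^ 2)).log hp).div_const 2).const_mul
      (c i * c j)
    convert! h using 1
    push_cast
    field_simp
  have hmono : MonotoneOn f (Set.Ioi 0) := by
    refine monotoneOn_of_deriv_nonneg (convex_Ioi 0)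
      (fun t ht => (hder t ht).continuousAt.continuousWithinAt) ?_ ?_
    · intro t ht
      rw [interior_Ioi] at ht
      exact (hder t ht).differentiableAt.differentiableWithinAt
    · intro t ht
      rw [interior_Ioi] at ht
      rw [(hder t ht).deriv]
      exact sum_sum_mul_cauchy_nonneg c x ht
  have hlim : Tendsto f atTop (𝓝 0) := by
    have h1 : Tendsto (fun t : ℝ => ∑ i, ∑ j, c i * c j *
        (Real.log ((x i - x j) ^ 2 / t ^ 2 + 1) / 2)) atTop
        (𝓝 (∑ i, ∑ j, c i * c j * (Real.log (0 + 1) / 2))) := by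
      refine tendsto_finsetSum _ fun i _ => tendsto_finsetSum _ fun j _ => ?_
      refine ((Tendsto.log ?_ (by norm_num)).div_const 2).const_mul _
      exact (tendsto_const_nhds.div_atTop (tendsto_pow_atTop two_ne_zero)).add_const 1
    simp only [zero_add, Real.log_one, zero_div, mul_zero, Finset.sum_const_zero] at h1
    refine h1.congr' ?_
    filter_upwards [eventually_gt_atTop 0] with t ht
    have h2 : ∀ i j, Real.log ((x i - x j) ^ 2 / t ^ 2 + 1) / 2 =
        Real.log ((x i - x j) ^ 2 + t ^ 2) / 2 - Real.log t := by
      intro i j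
      have : (x i - x j) ^ 2 / t ^ 2 + 1 = ((x i - x j) ^ 2 + t ^ 2) / t ^ 2 := by
        field_simp
      rw [this, Real.log_div (by positivity) (by positivity), Real.log_pow]
      push_cast
      ring
    simp_rw [h2, mul_sub, Finset.sum_sub_distrib]
    have h3 : ∑ i, ∑ j, c i * c j * Real.log t = 0 := by
      simp_rw [← Finset.sum_mul, ← Finset.mul_sum, hc]
      simp
    rw [h3, sub_zero]
  have hle : f ε ≤ 0 := by
    refine ge_of_tendsto hlim ?_
    filter_upwards [eventually_ge_atTop ε] with t ht
    exact hmono hε (hε.trans_le ht : 0 < t) ht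
  have : ∑ i, ∑ j, c i * c j * smoothKernel ε (x i) (x j) = -f ε := by
    simp only [hf, smoothKernel, mul_neg, Finset.sum_neg_distrib]
  rw [this]
  linarith

/-! ### Extended-real integrals -/

theorem extIntegral_mono_ae {X : Type*} [MeasurableSpace X] {μ : Measure X} {f g : X → EReal}
    (h : ∀ᵐ x ∂μ, f x ≤ g x) : extIntegral μ f ≤ extIntegral μ g := by
  refine EReal.sub_le_sub ?_ ?_
  · exact EReal.coe_ennreal_le_coe_ennreal_iff.mpr
      (lintegral_mono_ae (h.mono fun x hx => EReal.toENNReal_le_toENNReal hx))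
  · exact EReal.coe_ennreal_le_coe_ennreal_iff.mpr
      (lintegral_mono_ae (h.mono fun x hx => EReal.toENNReal_le_toENNReal
        (EReal.neg_le_neg_iff.mpr hx)))

theorem extIntegral_coe {X : Type*} [MeasurableSpace X] {μ : Measure X} {f : X → ℝ}
    (hf : Integrable f μ) :
    extIntegral μ (fun x => (f x : EReal)) = ((∫ x, f x ∂μ : ℝ) : EReal) := by
  have h2 : ∀ x, (-(f x : EReal)).toENNReal = ENNReal.ofReal (-f x) := fun x => by
    rw [← EReal.coe_neg, EReal.real_coe_toENNReal]
  rw [extIntegral, integral_eq_lintegral_pos_part_sub_lintegral_neg_part hf, EReal.coe_sub]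
  simp only [EReal.real_coe_toENNReal, h2]
  rw [EReal.coe_ennreal_toReal, EReal.coe_ennreal_toReal]
  · exact hf.neg.lintegral_lt_top.ne
  · exact hf.lintegral_lt_top.ne

/-- Monotone convergence for sequences bounded from below. -/
theorem tendsto_integral_extIntegral {X : Type*} [MeasurableSpace X] {μ : Measure X}
    [IsFiniteMeasure μ] {h : ℕ → X → ℝ} {f : X → EReal} {c : ℝ}
    (hint : ∀ n, Integrable (h n) μ) (hc : ∀ᵐ x ∂μ, ∀ n, c ≤ h n x)
    (hmono : ∀ᵐ x ∂μ, Monotone fun n => h n x)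
    (hlim : ∀ᵐ x ∂μ, Tendsto (fun n => (h n x : EReal)) atTop (𝓝 (f x))) :
    Tendsto (fun n => ((∫ x, h n x ∂μ : ℝ) : EReal)) atTop (𝓝 (extIntegral μ f)) := by
  simp_rw [← fun n => extIntegral_coe (hint n)]
  have h2 : ∀ y : ℝ, (-(y : EReal)).toENNReal = ENNReal.ofReal (-y) := fun y => by
    rw [← EReal.coe_neg, EReal.real_coe_toENNReal]
  have hpos : Tendsto (fun n => ∫⁻ x, (h n x : EReal).toENNReal ∂μ) atTop
      (𝓝 (∫⁻ x, (f x).toENNReal ∂μ)) := by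
    refine lintegral_tendsto_of_tendsto_of_monotone (fun n => (hint n).aemeasurable.ennreal_ofReal)
      ?_ ?_
    · filter_upwards [hmono] with x hx n m hnm
      exact ENNReal.ofReal_le_ofReal (hx hnm)
    · filter_upwards [hlim] with x hx
      exact (EReal.continuous_toENNReal.tendsto _).comp hx
  have hbound : ∫⁻ _, ENNReal.ofReal (-c) ∂μ ≠ ⊤ := by
    rw [lintegral_const]
    exact ENNReal.mul_ne_top ENNReal.ofReal_ne_top (measure_ne_top _ _)
  have hneg : Tendsto (fun n => ∫⁻ x, (-(h n x : EReal)).toENNReal ∂μ) atTop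
      (𝓝 (∫⁻ x, (-f x).toENNReal ∂μ)) := by
    refine tendsto_lintegral_of_dominated_convergence' (fun _ => ENNReal.ofReal (-c)) (fun n => ?_)
      (fun n => ?_) hbound ?_
    · simp_rw [h2]
      exact (hint n).aemeasurable.neg.ennreal_ofReal
    · filter_upwards [hc] with x hx
      rw [h2]
      exact ENNReal.ofReal_le_ofReal (neg_le_neg (hx n))
    · filter_upwards [hlim] with x hx
      exact ((EReal.continuous_toENNReal.comp continuous_neg).tendsto _).comp hx
  -- Finiteness of the negative part rules out `∞ - ∞`, where subtraction is not continuous.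
  have hfin : ∫⁻ x, (-f x).toENNReal ∂μ ≠ ⊤ := by
    refine ne_top_of_le_ne_top hbound (lintegral_mono_ae ?_)
    filter_upwards [hc, hlim] with x hx hl
    have hcf : (c : EReal) ≤ f x :=
      ge_of_tendsto' hl fun n => EReal.coe_le_coe_iff.mpr (hx n)
    rw [← h2]
    exact EReal.toENNReal_le_toENNReal (EReal.neg_le_neg_iff.mpr hcf)
  have hcont := EReal.continuousAt_add
    (p := ((∫⁻ x, (f x).toENNReal ∂μ : ENNReal), -((∫⁻ x, (-f x).toENNReal ∂μ : ENNReal) : EReal)))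
    (Or.inr (by simpa using hfin)) (Or.inl (EReal.coe_ennreal_ne_bot _))
  have hp' := (continuous_coe_ennreal_ereal.tendsto _).comp hpos
  have hn' := (continuous_neg.tendsto _).comp ((continuous_coe_ennreal_ereal.tendsto _).comp hneg)
  exact hcont.tendsto.comp (hp'.prodMk_nhds hn')

theorem integrable_of_continuous_of_ae_mem_compact {X : Type*} [TopologicalSpace X]
    [MeasurableSpace X] [OpensMeasurableSpace X] [T2Space X] {μ : Measure X} [IsFiniteMeasure μ]
    {s : Set X} (hs : IsCompact s) (hμ : ∀ᵐ x ∂μ, x ∈ s) {f : X → ℝ} (hf : Continuous f) :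
    Integrable f μ := by
  have h := hf.continuousOn.integrableOn_compact' (μ := μ) hs hs.measurableSet
  rwa [IntegrableOn, Measure.restrict_eq_self_of_ae_mem hμ] at h

/-! ### Smoothed potentials and discrete energy -/

/-- The potential of `μ` for the smoothed logarithmic kernel. -/
noncomputable def smoothPotential (μ : Measure ℝ) (ε x : ℝ) : ℝ := ∫ y, smoothKernel ε x y ∂μ

theorem continuous_smoothPotential {μ : Measure ℝ} [IsFiniteMeasure μ] {s : Set ℝ}
    (hs : IsCompact s) (hμ : ∀ᵐ x ∂μ, x ∈ s) {ε : ℝ} (hε : 0 < ε) :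
    Continuous (smoothPotential μ ε) := by
  have h := continuous_parametric_integral_of_continuous (μ := μ) (continuous_smoothKernel hε) hs
  rw [Measure.restrict_eq_self_of_ae_mem hμ] at h
  exact h

theorem integrable_smoothKernel {μ : Measure ℝ} [IsFiniteMeasure μ] {s : Set ℝ}
    (hs : IsCompact s) (hμ : ∀ᵐ x ∂μ, x ∈ s) {ε : ℝ} (hε : 0 < ε) (x : ℝ) :
    Integrable (smoothKernel ε x) μ :=
  integrable_of_continuous_of_ae_mem_compact hs hμ
    ((continuous_smoothKernel hε).comp (Continuous.prodMk_right x))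

theorem integrable_smoothKernel_prod {μ : Measure ℝ} [IsFiniteMeasure μ] {s : Set ℝ}
    (hs : IsCompact s) (hμ : ∀ᵐ x ∂μ, x ∈ s) {ε : ℝ} (hε : 0 < ε) :
    Integrable (Function.uncurry (smoothKernel ε)) (μ.prod μ) := by
  refine integrable_of_continuous_of_ae_mem_compact (hs.prod hs) ?_ (continuous_smoothKernel hε)
  filter_upwards [Measure.quasiMeasurePreserving_fst.ae hμ,
    Measure.quasiMeasurePreserving_snd.ae hμ] with p h1 h2
  exact ⟨h1, h2⟩

theorem map_pair_pi {ι : Type*} [Fintype ι] (μ : Measure ℝ) [IsProbabilityMeasure μ] {i j : ι}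
    (hij : i ≠ j) :
    (Measure.pi fun _ : ι => μ).map (fun w => (w i, w j)) = μ.prod μ := by
  have hind : iIndepFun (fun (k : ι) (w : ι → ℝ) => w k) (Measure.pi fun _ : ι => μ) :=
    iIndepFun_pi (X := fun _ => id) fun _ => aemeasurable_id
  have h := (indepFun_iff_map_prod_eq_prod_map_map (measurable_pi_apply i).aemeasurable
    (measurable_pi_apply j).aemeasurable).mp (hind.indepFun hij)
  rw [h]
  congr 1
  · exact (measurePreserving_eval (fun _ : ι => μ) i).map_eq
  · exact (measurePreserving_eval (fun _ : ι => μ) j).map_eq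

/-- The discrete energy of `n` points in the external field generated by `μ` is bounded by the
energy of `μ`. -/
theorem two_mul_sum_smoothPotential_le {μ : Measure ℝ} [IsProbabilityMeasure μ] {s : Set ℝ}
    (hs : IsCompact s) (hμ : ∀ᵐ x ∂μ, x ∈ s) {ε : ℝ} (hε : 0 < ε) {n : ℕ} (z : Fin n → ℝ) :
    2 * n * ∑ i, smoothPotential μ ε (z i) - ∑ i, ∑ j, smoothKernel ε (z i) (z j) ≤
      n * ((n - 1) * ∫ x, smoothPotential μ ε x ∂μ - Real.log ε) := by
  set P := Measure.pi fun _ : Fin n => μ with hP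
  have hmp : ∀ i, MeasurePreserving (fun w : Fin n → ℝ => w i) P μ :=
    fun i => measurePreserving_eval (fun _ : Fin n => μ) i
  have hcross : ∀ x i, Integrable (fun w : Fin n → ℝ => smoothKernel ε x (w i)) P := fun x i =>
    (hmp i).integrable_comp_of_integrable (integrable_smoothKernel hs hμ hε x)
  have hcross' : ∀ x i, ∫ w : Fin n → ℝ, smoothKernel ε x (w i) ∂P = smoothPotential μ ε x := by
    intro x i
    rw [smoothPotential, ← (hmp i).map_eq, integral_map (hmp i).aemeasurable]
    rw [(hmp i).map_eq]
    exact (integrable_smoothKernel hs hμ hε x).aestronglyMeasurable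
  have hpm : ∀ i j : Fin n, i ≠ j → MeasurePreserving (fun w : Fin n → ℝ => (w i, w j)) P
      (μ.prod μ) := fun i j hij => ⟨by fun_prop, map_pair_pi μ hij⟩
  have hpair : ∀ i j, Integrable (fun w : Fin n → ℝ => smoothKernel ε (w i) (w j)) P := by
    intro i j
    by_cases hij : i = j
    · subst hij
      simp_rw [smoothKernel_self]
      exact integrable_const _
    · exact (hpm i j hij).integrable_comp_of_integrable (integrable_smoothKernel_prod hs hμ hε)
  have hpair' : ∀ i j, ∫ w : Fin n → ℝ, smoothKernel ε (w i) (w j) ∂P =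
      if i = j then -Real.log ε else ∫ x, smoothPotential μ ε x ∂μ := by
    intro i j
    split_ifs with hij
    · subst hij
      simp_rw [smoothKernel_self]
      simp
    · have hi := integrable_smoothKernel_prod hs hμ hε
      have h := integral_map (hpm i j hij).aemeasurable
        (f := Function.uncurry (smoothKernel ε))
        (by rw [(hpm i j hij).map_eq]; exact hi.aestronglyMeasurable)
      rw [(hpm i j hij).map_eq, integral_prod _ hi] at h
      exact h.symm
  -- Positivity for charges `+1` at the `z i` and `-1` at the `w j`; the `w j` are then averaged
  -- over `μ^n`.
  have hdisc : ∀ w : Fin n → ℝ, 2 * ∑ i, ∑ j, smoothKernel ε (z i) (w j) -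
      ∑ i, ∑ j, smoothKernel ε (z i) (z j) ≤ ∑ i, ∑ j, smoothKernel ε (w i) (w j) := by
    intro w
    have h := sum_sum_mul_smoothKernel_nonneg (Sum.elim (fun _ : Fin n => (1 : ℝ)) fun _ => -1)
      (Sum.elim z w) (by simp) hε
    simp only [Fintype.sum_sum_type, Sum.elim_inl, Sum.elim_inr, one_mul, mul_neg,
      neg_mul, mul_one, Finset.sum_add_distrib, Finset.sum_neg_distrib] at h
    have h2 : ∑ i, ∑ j, smoothKernel ε (w i) (z j) = ∑ i, ∑ j, smoothKernel ε (z i) (w j) := by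
      rw [Finset.sum_comm]
      simp_rw [smoothKernel_comm ε (w _)]
    linarith
  have hintL : Integrable (fun w : Fin n → ℝ => ∑ i, ∑ j, smoothKernel ε (z i) (w j)) P :=
    integrable_finsetSum _ fun i _ => integrable_finsetSum _ fun j _ => hcross _ _
  have hintR : Integrable (fun w : Fin n → ℝ => ∑ i, ∑ j, smoothKernel ε (w i) (w j)) P :=
    integrable_finsetSum _ fun i _ => integrable_finsetSum _ fun j _ => hpair _ _
  have hI := integral_mono ((hintL.const_mul 2).sub (integrable_const _)) hintR hdisc
  rw [integral_sub' (hintL.const_mul 2) (integrable_const _), integral_const_mul,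
    integral_finsetSum _ fun i _ => integrable_finsetSum _ fun j _ => hcross _ _,
    integral_finsetSum _ fun i _ => integrable_finsetSum _ fun j _ => hpair _ _] at hI
  simp_rw [integral_finsetSum _ fun j _ => hcross _ j, hcross',
    integral_finsetSum _ fun j _ => hpair _ j, hpair'] at hI
  have hdiag : ∀ a b : ℝ, ∑ i : Fin n, ∑ j : Fin n, (if i = j then a else b) =
      n * ((n - 1) * b + a) := by
    intro a b
    have : ∀ i j : Fin n, (if i = j then a else b) = (if i = j then a - b else 0) + b := by
      intro i j
      split_ifs <;> ring
    simp_rw [this, Finset.sum_add_distrib]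
    simp
    ring
  rw [hdiag] at hI
  simp only [Finset.sum_const, Finset.card_univ, Fintype.card_fin, nsmul_eq_mul, integral_const,
    probReal_univ, smul_eq_mul, one_mul, ← Finset.mul_sum] at hI
  linarith

/-- Each factor `|z i - z j|` is at most `exp (-smoothKernel)`. The double sum counts every pair
twice, and `n * log ε` cancels its diagonal. -/
theorem abs_det_vandermonde_le {ε : ℝ} (hε : 0 < ε) {n : ℕ} (z : Fin n → ℝ) :
    |(Matrix.vandermonde z).det| ≤
      Real.exp (-(∑ i, ∑ j, smoothKernel ε (z i) (z j) + n * Real.log ε) / 2) := by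
  have h := Finset.sum_sum_Ioi_add_eq_sum_sum_off_diag fun i j => smoothKernel ε (z i) (z j)
  have h1 : ∀ i : Fin n, ∑ j ∈ {i}ᶜ, smoothKernel ε (z j) (z i) =
      ∑ j, smoothKernel ε (z i) (z j) + Real.log ε := by
    intro i
    rw [Fintype.sum_eq_add_sum_compl i, smoothKernel_self]
    simp_rw [smoothKernel_comm ε (z i)]
    ring
  have h2 : ∀ i j, smoothKernel ε (z j) (z i) + smoothKernel ε (z i) (z j) =
      2 * smoothKernel ε (z i) (z j) := by
    intro i j
    rw [smoothKernel_comm]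
    ring
  simp_rw [h1, h2, ← Finset.mul_sum, Finset.sum_add_distrib] at h
  simp only [Finset.sum_const, Finset.card_univ, Fintype.card_fin, nsmul_eq_mul] at h
  rw [← h, neg_div, mul_div_cancel_left₀ _ two_ne_zero, ← Finset.sum_neg_distrib, Real.exp_sum,
    Matrix.det_vandermonde, Finset.abs_prod]
  refine Finset.prod_le_prod (fun i _ => abs_nonneg _) fun i _ => ?_
  rw [← Finset.sum_neg_distrib, Real.exp_sum, Finset.abs_prod]
  refine Finset.prod_le_prod (fun i _ => abs_nonneg _) fun j _ => ?_
  rw [abs_sub_comm]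
  exact abs_sub_le_exp_neg_smoothKernel hε _ _

/-! ### Small integral polynomials and the limit `ε → 0` -/

/-- Integral polynomials which are small relative to the potential of `μ`. -/
theorem exists_polynomial_abs_aeval_le {μ : Measure ℝ} [IsProbabilityMeasure μ] {s : Set ℝ}
    (hs : IsCompact s) (hinf : s.Infinite) (hμ : ∀ᵐ x ∂μ, x ∈ s) {ε : ℝ} (hε : 0 < ε) {n : ℕ}
    (hn : n ≠ 0) :
    ∃ Q : Polynomial ℤ, Q ≠ 0 ∧ ∀ x ∈ s, |Polynomial.aeval x Q| ≤
      n * Real.exp ((n - 1) * (∫ x, smoothPotential μ ε x ∂μ) / 2 - Real.log ε + 1 -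
        n * smoothPotential μ ε x) := by
  set g := smoothPotential μ ε with hg
  have hgc : Continuous g := continuous_smoothPotential hs hμ hε
  set φ : ℝ → Fin n → ℝ := fun x j => Real.exp (n * g x) * x ^ (j : ℕ) with hφ
  have hdet : ∀ z : Fin n → ℝ, (Matrix.of fun i => φ (z i)).det =
      (∏ i, Real.exp (n * g (z i))) * (Matrix.vandermonde z).det := fun z =>
    Matrix.det_mul_column _ _
  obtain ⟨y, hy⟩ := hinf.natEmbedding
  have hy0 : (Matrix.of fun i : Fin n => φ (y i)).det ≠ 0 := by
    rw [hdet fun i => (y i : ℝ)]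
    refine mul_ne_zero (Finset.prod_ne_zero_iff.mpr fun i _ => (Real.exp_pos _).ne')
      (Matrix.det_vandermonde_ne_zero_iff.mpr fun i j hij => ?_)
    exact Fin.val_injective (hy (Subtype.val_injective hij))
  set κ := ∫ x, g x ∂μ with hκ
  -- The term `-log ε` collects two halves, from the diagonals of the averaged energy and of the
  -- Vandermonde bound; the `+ 1` makes the inequality strict.
  obtain ⟨v, hv0, hv⟩ := exists_int_ne_zero_abs_dotProduct_le φ
    (by fun_prop) hs (fun i : Fin n => y i) (fun i => (y i).2)
    hy0 (Real.exp_pos ((n - 1) * κ / 2 - Real.log ε + 1)) (by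
      intro z
      rw [hdet, abs_mul, ← Real.exp_sum, abs_of_pos (Real.exp_pos _), ← Real.exp_nat_mul]
      refine (mul_le_mul_of_nonneg_left (abs_det_vandermonde_le hε z) (Real.exp_pos _).le).trans_lt
        ?_
      rw [← Real.exp_add, Real.exp_lt_exp, ← Finset.mul_sum]
      have h := two_mul_sum_smoothPotential_le hs hμ hε z
      have hn' : (0 : ℝ) < n := by positivity
      rw [← hg, ← hκ] at h
      nlinarith)
  refine ⟨∑ j : Fin n, Polynomial.monomial j (v j), ?_, fun x hx => ?_⟩
  · obtain ⟨j, hj⟩ := Function.ne_iff.mp hv0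
    intro h0
    apply hj
    have := congrArg (fun Q => Q.coeff (j : ℕ)) h0
    simpa [Polynomial.finsetSum_coeff, Polynomial.coeff_monomial, Fin.val_inj] using this
  · have h := hv x hx
    have h1 : (φ x ⬝ᵥ fun j => (v j : ℝ)) = Real.exp (n * g x) *
        Polynomial.aeval x (∑ j : Fin n, Polynomial.monomial (j : ℕ) (v j)) := by
      simp only [dotProduct, hφ, map_sum, Polynomial.aeval_monomial, Finset.mul_sum,
        algebraMap_int_eq, eq_intCast]
      exact Finset.sum_congr rfl fun j _ => by ring
    rw [h1, abs_mul, abs_of_pos (Real.exp_pos _)] at h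
    rw [Real.exp_sub, ← mul_div_assoc, le_div_iff₀ (Real.exp_pos _)]
    linarith

/-- If `κ > 0`, integrating the bound on `log |Q|` gives `0 ≤ log n + 1 - log ε - (n + 1) κ / 2`,
false for large `n`. -/
theorem integral_smoothPotential_le_zero {μ : Measure ℝ} [IsProbabilityMeasure μ] {s : Set ℝ}
    (hs : IsCompact s) (hinf : s.Infinite) (hμ : ∀ᵐ x ∂μ, x ∈ s)
    (hQ : ∀ Q : Polynomial ℤ, Q ≠ 0 →
      0 ≤ extIntegral μ (fun x : ℝ => logAbs (Polynomial.aeval x Q)))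
    {ε : ℝ} (hε : 0 < ε) : ∫ x, smoothPotential μ ε x ∂μ ≤ 0 := by
  by_contra! hκ
  set g := smoothPotential μ ε with hg
  set κ := ∫ x, g x ∂μ with hκdef
  have hgc : Continuous g := continuous_smoothPotential hs hμ hε
  have hgi : Integrable g μ := integrable_of_continuous_of_ae_mem_compact hs hμ hgc
  have hlog : Tendsto (fun n : ℕ => Real.log n / n) atTop (𝓝 0) := by
    have h := (Real.isLittleO_log_id_atTop.tendsto_div_nhds_zero).comp tendsto_natCast_atTop_atTop
    exact h
  have hconst : Tendsto (fun n : ℕ => (1 - Real.log ε) / n) atTop (𝓝 0) :=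
    tendsto_const_nhds.div_atTop tendsto_natCast_atTop_atTop
  have hsum := hlog.add hconst
  rw [add_zero] at hsum
  obtain ⟨n, hn, hn0⟩ := ((hsum.eventually (gt_mem_nhds (half_pos hκ))).and
    (eventually_gt_atTop 0)).exists
  have hn' : (0 : ℝ) < n := by exact_mod_cast hn0
  rw [← add_div, div_lt_iff₀ hn'] at hn
  obtain ⟨Q, hQ0, hQb⟩ := exists_polynomial_abs_aeval_le hs hinf hμ hε hn0.ne'
  rw [← hg, ← hκdef] at hQb
  set C := Real.log n + ((n - 1) * κ / 2 - Real.log ε + 1) with hC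
  have hle : ∀ᵐ x ∂μ, logAbs (Polynomial.aeval x Q) ≤ ((C - n * g x : ℝ) : EReal) := by
    filter_upwards [hμ] with x hx
    rw [logAbs, Real.enorm_eq_ofReal_abs]
    have h := hQb x hx
    refine (ENNReal.log_monotone (ENNReal.ofReal_le_ofReal h)).trans ?_
    rw [ENNReal.log_ofReal_of_pos (mul_pos hn' (Real.exp_pos _)),
      Real.log_mul hn'.ne' (Real.exp_pos _).ne', Real.log_exp, hC]
    exact (congrArg Real.toEReal (by ring)).le
  have h1 := (hQ Q hQ0).trans (extIntegral_mono_ae hle)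
  rw [extIntegral_coe (f := fun x => C - n * g x) ((integrable_const C).sub (hgi.const_mul n)),
    integral_sub (integrable_const C) (hgi.const_mul n), integral_const_mul, integral_const,
    probReal_univ, one_smul, ← hκdef] at h1
  have h2 : 0 ≤ C - n * κ := by exact_mod_cast h1
  rw [hC] at h2
  nlinarith

/-- The kernels increase as `ε` decreases and are bounded below on the square, so monotone
convergence applies to the inner integral and then to the outer one. -/
theorem tendsto_integral_smoothPotential_energy {μ : Measure ℝ} [IsProbabilityMeasure μ] {R : ℝ}
    (hμ : ∀ᵐ x ∂μ, x ∈ Set.Icc (-R) R) :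
    Tendsto (fun n : ℕ => ((∫ x, smoothPotential μ (1 / (n + 1)) x ∂μ : ℝ) : EReal)) atTop
      (𝓝 (energy μ)) := by
  have hs : IsCompact (Set.Icc (-R) R) := isCompact_Icc
  have hε : ∀ n : ℕ, (0 : ℝ) < 1 / (n + 1) := fun n => Nat.one_div_pos_of_nat
  have hanti : ∀ n m : ℕ, n ≤ m → (1 : ℝ) / (m + 1) ≤ 1 / (n + 1) := fun n m h =>
    Nat.one_div_le_one_div h
  have hε0 : Tendsto (fun n : ℕ => (1 : ℝ) / (n + 1)) atTop (𝓝[>] 0) :=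
    tendsto_nhdsWithin_iff.mpr ⟨tendsto_one_div_add_atTop_nhds_zero_nat,
      Eventually.of_forall hε⟩
  have hmono : ∀ x y, Monotone fun n : ℕ => smoothKernel (1 / (n + 1)) x y :=
    fun x y n m h => smoothKernel_anti (hε m) (hanti n m h) x y
  set c := -(Real.log ((2 * R) ^ 2 + 1) / 2) with hc
  have hlow : ∀ x ∈ Set.Icc (-R) R, ∀ y ∈ Set.Icc (-R) R, ∀ n : ℕ,
      c ≤ smoothKernel (1 / (n + 1)) x y := by
    intro x hx y hy n
    refine le_trans ?_ (hmono x y (Nat.zero_le n))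
    simp only [hc, smoothKernel]
    have : (x - y) ^ 2 ≤ (2 * R) ^ 2 :=
      sq_le_sq' (by linarith [hx.1, hy.2]) (by linarith [hx.2, hy.1])
    rw [show (1 : ℝ) / ((0 : ℕ) + 1) = 1 by norm_num, one_pow]
    gcongr
  have hint : ∀ n : ℕ, ∀ x, Integrable (smoothKernel (1 / (n + 1)) x) μ := fun n x =>
    integrable_smoothKernel hs hμ (hε n) x
  refine tendsto_integral_extIntegral (c := c) (fun n =>
    integrable_of_continuous_of_ae_mem_compact hs hμ (continuous_smoothPotential hs hμ (hε n)))
    ?_ ?_ ?_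
  · filter_upwards [hμ] with x hx n
    have h := integral_mono_ae (integrable_const c) (hint n x)
      (hμ.mono fun y hy => hlow x hx y hy n)
    rw [integral_const, probReal_univ, one_smul] at h
    exact h
  · exact Eventually.of_forall fun x n m h => integral_mono (hint n x) (hint m x)
      fun y => hmono x y h
  · filter_upwards [hμ] with x hx
    exact tendsto_integral_extIntegral (c := c) (fun n => hint n x)
      (hμ.mono fun y hy n => hlow x hx y hy n) (Eventually.of_forall fun y => hmono x y)
      (Eventually.of_forall fun y => (tendsto_smoothKernel x y).comp hε0)

end LogPotential

theorem mainTheorem9 (K : Set ℝ) (hK : IsCompact K) (μ : Measure ℝ) [IsProbabilityMeasure μ]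
    (hμK : μ.support ⊆ K)
    (hμ : ∀ Q : Polynomial ℤ, Q ≠ 0 →
      0 ≤ LogPotential.extIntegral μ (fun x : ℝ => LogPotential.logAbs (Polynomial.aeval x Q))) :
    LogPotential.energy μ ≤ 0 := by
  -- An interval replaces `K`, which may be finite, so that there are `n` distinct nodes for every
  -- `n`.
  obtain ⟨R, hR0, hR⟩ := hK.isBounded.subset_closedBall_lt 0 0
  rw [Real.closedBall_eq_Icc, zero_sub, zero_add] at hR
  have hmem : ∀ᵐ x ∂μ, x ∈ Set.Icc (-R) R :=
    Filter.mem_of_superset Measure.support_mem_ae (hμK.trans hR)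
  refine le_of_tendsto' (LogPotential.tendsto_integral_smoothPotential_energy hmem) fun n => ?_
  exact EReal.coe_nonpos.mpr (LogPotential.integral_smoothPotential_le_zero isCompact_Icc
    (Set.Icc_infinite (by linarith)) hmem hμ Nat.one_div_pos_of_nat)
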